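/- Let $Y_1,\dots,Y_q$ be locally Lipschitz continuous vector fields on $\mathbb{R}^n$, written $Y_j=g_j\cdot\nabla$. For $x\in\mathbb{R}^n$ and $r>0$ write $Y_{j,x}:=Y_j(x)$, $p_x:=\dim\operatorname{span}\{Y_{1,x},\dots,Y_{q,x}\}$ and $P_x^r:=\{\sum_{j=1}^q c_jY_{j,x}: c\in\mathbb{R}^q,\ |c|\le r\}$. Assume that for every bounded open set $\Omega\subset\mathbb{R}^n$ there is a constant $C_\Omega>0$ such that, for all $j,k\in\{1,\dots,q\}$, $$[Y_j,Y_k]_x:=(Y_jg_k(x)-Y_kg_j(x))\cdot\nabla\in P_x^{C_\Omega}\quad\text{for a.e. }x\in\Omega,$$ where $Y_jg_k(x)=g_j(x)\cdot\nabla g_k(x)$ exists for a.e. $x$ by Rademacher's theorem. A path $\gamma:[0,T]\to\mathbb{R}^n$ is called subunit if it is Lipschitz and there is $u\in L^\infty((0,T),\mathbb{R}^q)$ with $|u(t)|\le1$ and $\dot\gamma(t)=\sum_{j=1}^q u_j(t)Y_j(\gamma(t))$ for a.e. $t\in(0,T)$. Let $d(x,y)$ be the infimum of all $T\ge0$ such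 that there is a subunit path $\gamma$ on $[0,T]$ with $\gamma(0)=x$ and $\gamma(T)=y$ (with $d(x,y)=\infty$ if there is none), and let $\mathcal{O}^{x}:=\{y\in\mathbb{R}^n: d(x,y)<\infty\}$ be the orbit of $x$. Then, for every $x_0\in\mathbb{R}^n$, we have $p_x=p_{x_0}$ for all $x\in\mathcal{O}^{x_0}$. -/

import Mathlib

open MeasureTheory Set
open scoped ENNReal NNReal

/-- A vector field `g · ∇` on `ℝⁿ` is identified with its coefficient map `g : ℝⁿ → ℝⁿ`. -/
abbrev VField (n : ℕ) : Type :=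
  EuclideanSpace ℝ (Fin n) → EuclideanSpace ℝ (Fin n)

/-- The subspace `P_x = span {Y_{1,x}, …, Y_{q,x}}`. -/
def distribution {n q : ℕ} (Y : Fin q → VField n) (x : EuclideanSpace ℝ (Fin n)) :
    Submodule ℝ (EuclideanSpace ℝ (Fin n)) :=
  Submodule.span ℝ (range fun j => Y j x)

/-- The rank `p_x = dim P_x`. -/
noncomputable def rankAt {n q : ℕ} (Y : Fin q → VField n) (x : EuclideanSpace ℝ (Fin n)) : ℕ :=
  Module.finrank ℝ (distribution Y x)

/-- The set `P_x^r = {∑ⱼ cⱼ Y_{j,x} : |c| ≤ r}`, with the Euclidean norm of `c ∈ ℝ^q`. -/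
def distributionBall {n q : ℕ} (Y : Fin q → VField n) (x : EuclideanSpace ℝ (Fin n)) (r : ℝ) :
    Set (EuclideanSpace ℝ (Fin n)) :=
  {v | ∃ c : EuclideanSpace ℝ (Fin q), ‖c‖ ≤ r ∧ v = ∑ j, c j • Y j x}

/-- The quantitative almost-everywhere finite type involutivity condition: on every bounded open
`Ω` there is a constant `C > 0` with `[Y_j, Y_k]_x ∈ P_x^C` for all `j`, `k` and a.e. `x ∈ Ω`.
Here `VectorField.lieBracket ℝ V W x = DW(x) (V x) - DV(x) (W x)`; for locally Lipschitz fields the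
derivatives exist almost everywhere. -/
def FiniteTypeInvolutive {n q : ℕ} (Y : Fin q → VField n) : Prop :=
  ∀ Ω : Set (EuclideanSpace ℝ (Fin n)), IsOpen Ω → Bornology.IsBounded Ω →
    ∃ C : ℝ, 0 < C ∧ ∀ j k : Fin q, ∀ᵐ x ∂(volume.restrict Ω),
      VectorField.lieBracket ℝ (Y j) (Y k) x ∈ distributionBall Y x C

/-- `γ` restricted to `[0, T]` is a subunit path: it is Lipschitz, and there is a control
`u ∈ L^∞((0,T), ℝ^q)` with `|u(t)| ≤ 1` and `γ'(t) = ∑ⱼ uⱼ(t) Yⱼ(γ(t))` for a.e. `t ∈ (0,T)`. -/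
def IsSubunit {n q : ℕ} (Y : Fin q → VField n) (T : ℝ) (γ : ℝ → EuclideanSpace ℝ (Fin n)) :
    Prop :=
  (∃ K : ℝ≥0, LipschitzOnWith K γ (Icc 0 T)) ∧
  ∃ u : ℝ → EuclideanSpace ℝ (Fin q),
    MemLp u ∞ (volume.restrict (Ioo 0 T)) ∧
    ∀ᵐ t ∂(volume.restrict (Ioo 0 T)),
      ‖u t‖ ≤ 1 ∧ HasDerivAt γ (∑ j, u t j • Y j (γ t)) t

/-- The Carnot–Carathéodory distance: the infimum of the `T ≥ 0` for which `x` and `y` are joined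
by a subunit path on `[0, T]`, equal to `∞` if there is none. -/
noncomputable def ccDist {n q : ℕ} (Y : Fin q → VField n) (x y : EuclideanSpace ℝ (Fin n)) :
    ℝ≥0∞ :=
  sInf {a | ∃ T : ℝ, 0 ≤ T ∧ a = ENNReal.ofReal T ∧
    ∃ γ : ℝ → EuclideanSpace ℝ (Fin n), IsSubunit Y T γ ∧ γ 0 = x ∧ γ T = y}

/-- The orbit `O^x = {y : d(x, y) < ∞}`. -/
def orbit {n q : ℕ} (Y : Fin q → VField n) (x : EuclideanSpace ℝ (Fin n)) :
    Set (EuclideanSpace ℝ (Fin n)) :=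
  {y | ccDist Y x y < ∞}

/-!
For each `p`, let `F` be the vector of all `p × p` minors of the `q × n` matrix with rows
`Y_{1,x}, …, Y_{q,x}`; the rank at `x` is at least `p` exactly when `F x ≠ 0`. So it is enough that
the vanishing of `F` propagates along subunit paths in both directions.

At a point where the fields are differentiable, `D Yᵢ(Yⱼ) = D Yⱼ(Yᵢ) + [Yⱼ, Yᵢ]`. The first term is a
linear map applied to `Yᵢ`, and the second is a bounded combination of the fields, so along a velocity
`∑ uⱼ Yⱼ` the coefficient matrix `G` moves with velocity `G A + B G`, with `A` and `B` bounded. By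
Jacobi's formula the minors then move with velocity at most `c |F|`: multiplying on the right mixes
the columns and multiplying on the left mixes the rows
(`fderiv_apply_eq_mul_add_mul_add`, `Matrix.abs_sum_mul_adjugate_le`).

This holds only almost everywhere in `ℝⁿ`, whereas a path is a null set. By Fubini
(`ae_ae_add_of_ae`), almost every translate `γ + z` of the path meets good points at almost every
time. The velocity of `γ + z` is a combination of the fields at `γ` instead of `γ + z`, which costs an
error `O(|z|)` since the fields are locally Lipschitz. Integrating and letting `z → 0` gives
`|F(γ t) - F(γ s)| ≤ c ∫ₛᵗ |F(γ)|` (`exists_norm_minors_sub_le_integral`), and Grönwall's lemma, applied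
forwards and backwards in time, concludes.
-/

/-! ### Rank and minors -/

theorem Matrix.exists_linearIndependent_row_of_le_rank {m k : Type*} [Fintype m] [Fintype k]
    (A : Matrix m k ℝ) {p : ℕ} (hp : p ≤ A.rank) :
    ∃ I : Fin p → m, LinearIndependent ℝ fun a => A (I a) := by
  obtain ⟨κ, a, ha, hsp, hli⟩ := exists_linearIndependent' ℝ A.row
  have : Finite κ := Finite.of_injective a ha
  have := Fintype.ofFinite κ
  have hcard : p ≤ Fintype.card κ := by
    rw [Matrix.rank_eq_finrank_span_row, ← hsp, finrank_span_eq_card hli] at hp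
    exact hp
  obtain ⟨e⟩ : Nonempty (Fin p ↪ κ) :=
    Function.Embedding.nonempty_of_card_le (by simpa using hcard)
  exact ⟨a ∘ e, hli.comp e e.injective⟩

theorem Matrix.le_rank_iff_exists_det_submatrix_ne_zero {m k : Type*} [Fintype m] [Fintype k]
    (A : Matrix m k ℝ) (p : ℕ) :
    p ≤ A.rank ↔ ∃ (I : Fin p → m) (K : Fin p → k), (A.submatrix I K).det ≠ 0 := by
  constructor
  · intro hp
    obtain ⟨I, hI⟩ := A.exists_linearIndependent_row_of_le_rank hp
    have hr : (A.submatrix I id).rank = p := by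
      simpa using LinearIndependent.rank_matrix (M := A.submatrix I id) hI
    obtain ⟨K, hK⟩ := (A.submatrix I id).transpose.exists_linearIndependent_row_of_le_rank
      (p := p) (by rw [Matrix.rank_transpose, hr])
    refine ⟨I, K, ?_⟩
    have h : LinearIndependent ℝ (A.submatrix I K).col := hK
    exact ((Matrix.isUnit_iff_isUnit_det _).1
      (Matrix.linearIndependent_cols_iff_isUnit.1 h)).ne_zero
  · rintro ⟨I, K, h⟩
    calc p = (A.submatrix I K).rank := by
          simpa using (Matrix.rank_of_isUnit _
            ((Matrix.isUnit_iff_isUnit_det _).2 (isUnit_iff_ne_zero.2 h))).symm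
      _ ≤ A.rank := Matrix.rank_submatrix_le A I K

/-! ### Minors of a moving matrix -/

theorem Matrix.det_updateRow_eq_sum {p : Type*} [Fintype p] [DecidableEq p]
    (S : Matrix p p ℝ) (a : p) (v : p → ℝ) :
    (S.updateRow a v).det = ∑ b, v b * S.adjugate b a := by
  rw [Matrix.det_eq_sum_mul_adjugate_row _ a]
  refine Finset.sum_congr rfl fun b _ => ?_
  simp [Matrix.adjugate_apply]

theorem Matrix.det_updateCol_eq_sum {p : Type*} [Fintype p] [DecidableEq p]
    (S : Matrix p p ℝ) (b : p) (v : p → ℝ) :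
    (S.updateCol b v).det = ∑ a, v a * S.adjugate b a := by
  rw [← Matrix.det_transpose, ← Matrix.updateRow_transpose, Matrix.det_updateRow_eq_sum,
    ← Matrix.adjugate_transpose]
  rfl

/-- Jacobi's formula for the derivative of a determinant. -/
theorem HasDerivAt.matrix_det {p : Type*} [Fintype p] [DecidableEq p]
    {S : ℝ → Matrix p p ℝ} {S' : Matrix p p ℝ} {t : ℝ}
    (h : ∀ a b, HasDerivAt (fun τ => S τ a b) (S' a b) t) :
    HasDerivAt (fun τ => (S τ).det) (∑ a, ∑ b, S' a b * (S t).adjugate b a) t := by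
  have hS : ∑ a, ∑ b, S' a b * (S t).adjugate b a
      = ∑ σ : Equiv.Perm p, ((Equiv.Perm.sign σ : ℤ) : ℝ) *
          ∑ b, (∏ i ∈ Finset.univ.erase b, S t (σ i) i) * S' (σ b) b := by
    rw [Finset.sum_comm]
    simp_rw [Finset.mul_sum]
    rw [Finset.sum_comm (s := (Finset.univ : Finset (Equiv.Perm p)))]
    refine Finset.sum_congr rfl fun b _ => ?_
    rw [← Matrix.det_updateCol_eq_sum (S t) b (fun a => S' a b), Matrix.det_apply']
    refine Finset.sum_congr rfl fun σ _ => ?_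
    rw [← Finset.mul_prod_erase _ _ (Finset.mem_univ b), Matrix.updateCol_self,
      mul_comm (S' (σ b) b)]
    congr 2
    refine Finset.prod_congr rfl fun i hi => ?_
    rw [Matrix.updateCol_ne (Finset.ne_of_mem_erase hi)]
  rw [hS]
  simp_rw [Matrix.det_apply']
  refine HasDerivAt.fun_sum fun σ _ => HasDerivAt.const_mul _ ?_
  simpa using HasDerivAt.fun_finsetProd (u := Finset.univ) fun i _ => h (σ i) i

/-- The family of all `p × p` minors of a matrix, repeated and permuted indices included. -/
def Matrix.minors {m k : Type*} (p : ℕ) (G : Matrix m k ℝ) :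
    (Fin p → m) × (Fin p → k) → ℝ :=
  fun s => (G.submatrix s.1 s.2).det

/-- The linearization of the minor `(I, K)` at `G` in the direction `G * A` is a combination of
minors of `G` in which one column index has been replaced. -/
theorem Matrix.sum_mul_adjugate_of_mul_right {m k : Type*} [Fintype m] [Fintype k]
    [DecidableEq k] {p : ℕ}
    (G : Matrix m k ℝ) (A : Matrix k k ℝ) (I : Fin p → m) (K : Fin p → k) :
    ∑ a, ∑ b, (G * A) (I a) (K b) * (G.submatrix I K).adjugate b a
      = ∑ b, ∑ c, A c (K b) * G.minors p (I, Function.update K b c) := by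
  rw [Finset.sum_comm]
  refine Finset.sum_congr rfl fun b _ => ?_
  have h : ∀ c, G.minors p (I, Function.update K b c)
      = ∑ a, G (I a) c * (G.submatrix I K).adjugate b a := fun c => by
    rw [← Matrix.det_updateCol_eq_sum (G.submatrix I K) b fun a => G (I a) c, Matrix.minors]
    congr 1
    ext i j
    by_cases hj : j = b
    · subst hj; simp
    · simp [hj]
  simp_rw [h, Matrix.mul_apply, Finset.sum_mul, Finset.mul_sum]
  rw [Finset.sum_comm]
  exact Finset.sum_congr rfl fun c _ => Finset.sum_congr rfl fun a _ => by ring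

/-- The linearization of the minor `(I, K)` at `G` in the direction `B * G` is a combination of
minors of `G` in which one row index has been replaced. -/
theorem Matrix.sum_mul_adjugate_of_mul_left {m k : Type*} [Fintype m] [Fintype k]
    [DecidableEq m] {p : ℕ}
    (G : Matrix m k ℝ) (B : Matrix m m ℝ) (I : Fin p → m) (K : Fin p → k) :
    ∑ a, ∑ b, (B * G) (I a) (K b) * (G.submatrix I K).adjugate b a
      = ∑ a, ∑ l, B (I a) l * G.minors p (Function.update I a l, K) := by
  refine Finset.sum_congr rfl fun a _ => ?_
  have h : ∀ l, G.minors p (Function.update I a l, K)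
      = ∑ b, G l (K b) * (G.submatrix I K).adjugate b a := fun l => by
    rw [← Matrix.det_updateRow_eq_sum (G.submatrix I K) a fun b => G l (K b), Matrix.minors]
    congr 1
    ext i j
    by_cases hi : i = a
    · subst hi; simp
    · simp [hi]
  simp_rw [h, Matrix.mul_apply, Finset.sum_mul, Finset.mul_sum]
  rw [Finset.sum_comm]
  exact Finset.sum_congr rfl fun c _ => Finset.sum_congr rfl fun a _ => by ring

theorem Matrix.abs_adjugate_le {p : ℕ} {S : Matrix (Fin p) (Fin p) ℝ} {M : ℝ} (hM : 1 ≤ M)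
    (hS : ∀ a b, |S a b| ≤ M) (a b : Fin p) : |S.adjugate b a| ≤ p.factorial * M ^ p := by
  rw [Matrix.adjugate_apply]
  have := Matrix.det_le (A := S.updateRow a (Pi.single b 1)) (abv := AbsoluteValue.abs) (x := M)
    fun i j => by
      by_cases hi : i = a
      · subst hi
        by_cases hj : j = b
        · subst hj; simpa using hM
        · simpa [hj] using zero_le_one.trans hM
      · simpa [hi] using hS i j
  simpa [nsmul_eq_mul] using this

theorem abs_sum_sum_le {ι κ : Type*} [Fintype ι] [Fintype κ] (f : ι → κ → ℝ) (c : ℝ)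
    (hf : ∀ i j, |f i j| ≤ c) :
    |∑ i, ∑ j, f i j| ≤ Fintype.card ι * (Fintype.card κ * c) := by
  refine (Finset.abs_sum_le_sum_abs _ _).trans ?_
  refine (Finset.sum_le_card_nsmul _ _ (Fintype.card κ * c) fun i _ => ?_).trans_eq (by simp)
  refine (Finset.abs_sum_le_sum_abs _ _).trans ?_
  exact (Finset.sum_le_card_nsmul _ _ c fun j _ => hf i j).trans_eq (by simp)

/-- If a matrix moves with velocity `G * A + B * G + E`, its minors move with a velocity bounded
by the minors themselves, up to an error proportional to `E`. -/
theorem Matrix.abs_sum_mul_adjugate_le {m k : Type*} [Fintype m] [Fintype k]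
    [DecidableEq m] [DecidableEq k] {p : ℕ}
    (G : Matrix m k ℝ) (A : Matrix k k ℝ) (B : Matrix m m ℝ) (E : Matrix m k ℝ)
    {α β δ M : ℝ} (hM : 1 ≤ M) (hG : ∀ i j, |G i j| ≤ M) (hA : ∀ i j, |A i j| ≤ α)
    (hB : ∀ i j, |B i j| ≤ β) (hE : ∀ i j, |E i j| ≤ δ) (I : Fin p → m) (K : Fin p → k) :
    |∑ a, ∑ b, (G * A + B * G + E) (I a) (K b) * (G.submatrix I K).adjugate b a|
      ≤ (p * (Fintype.card k * α) + p * (Fintype.card m * β)) * ‖G.minors p‖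
        + p * (p * (δ * (p.factorial * M ^ p))) := by
  have hm : ∀ s, |G.minors p s| ≤ ‖G.minors p‖ := fun s => norm_le_pi_norm (G.minors p) s
  simp_rw [Matrix.add_apply, add_mul, Finset.sum_add_distrib]
  rw [G.sum_mul_adjugate_of_mul_right, G.sum_mul_adjugate_of_mul_left]
  have h1 := abs_sum_sum_le (fun (b : Fin p) c => A c (K b) * G.minors p (I, Function.update K b c))
    (α * ‖G.minors p‖) fun b c => by
      rw [abs_mul]
      exact mul_le_mul (hA _ _) (hm _) (abs_nonneg _) ((abs_nonneg _).trans (hA c (K b)))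
  have h2 := abs_sum_sum_le (fun (a : Fin p) l => B (I a) l * G.minors p (Function.update I a l, K))
    (β * ‖G.minors p‖) fun a l => by
      rw [abs_mul]
      exact mul_le_mul (hB _ _) (hm _) (abs_nonneg _) ((abs_nonneg _).trans (hB (I a) l))
  have h3 := abs_sum_sum_le (fun (a b : Fin p) => E (I a) (K b) * (G.submatrix I K).adjugate b a)
    (δ * (p.factorial * M ^ p)) fun a b => by
      rw [abs_mul]
      exact mul_le_mul (hE _ _) (abs_adjugate_le hM (fun _ _ => hG _ _) a b) (abs_nonneg _)
        ((abs_nonneg _).trans (hE (I a) (K b)))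
  simp only [Fintype.card_fin] at h1 h2 h3
  refine (abs_add_three _ _ _).trans ?_
  linarith

/-! ### The coefficient matrix of a family of vector fields -/

/-- The `q × n` matrix whose rows are the coefficient vectors `Y_{1,x}, …, Y_{q,x}`. -/
def coeffMatrix {n q : ℕ} (Y : Fin q → VField n) (x : EuclideanSpace ℝ (Fin n)) :
    Matrix (Fin q) (Fin n) ℝ :=
  fun j i => Y j x i

theorem rankAt_eq_rank_coeffMatrix {n q : ℕ} (Y : Fin q → VField n)
    (x : EuclideanSpace ℝ (Fin n)) : rankAt Y x = (coeffMatrix Y x).rank := by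
  rw [rankAt, Matrix.rank_eq_finrank_span_row, distribution,
    ← LinearEquiv.finrank_map_eq (WithLp.linearEquiv 2 ℝ (Fin n → ℝ)), Submodule.map_span,
    ← Set.range_comp]
  rfl

theorem le_rankAt_iff {n q : ℕ} (Y : Fin q → VField n) (x : EuclideanSpace ℝ (Fin n)) (p : ℕ) :
    p ≤ rankAt Y x ↔ (coeffMatrix Y x).minors p ≠ 0 := by
  rw [rankAt_eq_rank_coeffMatrix, Matrix.le_rank_iff_exists_det_submatrix_ne_zero,
    Function.ne_iff, Prod.exists]
  rfl

theorem LocallyLipschitz.pi {X ι : Type*} [PseudoEMetricSpace X] [Fintype ι] {Z : ι → Type*}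
    [∀ i, PseudoEMetricSpace (Z i)] {f : ∀ i, X → Z i} (hf : ∀ i, LocallyLipschitz (f i)) :
    LocallyLipschitz fun x i => f i x := by
  intro x
  choose K t ht h using fun i => hf i x
  refine ⟨∑ i, K i, ⋂ i, t i, Filter.iInter_mem.2 ht, fun y hy z hz => ?_⟩
  refine edist_pi_le_iff.2 fun i => (h i (mem_iInter.1 hy i) (mem_iInter.1 hz i)).trans ?_
  gcongr
  exact Finset.single_le_sum (f := K) (fun _ _ => zero_le) (Finset.mem_univ i)

theorem locallyLipschitz_coeffMatrix_apply {n q : ℕ} {Y : Fin q → VField n}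
    (hY : ∀ j, LocallyLipschitz (Y j)) (j : Fin q) (i : Fin n) :
    LocallyLipschitz fun x => coeffMatrix Y x j i :=
  ((EuclideanSpace.proj (𝕜 := ℝ) i).lipschitz.locallyLipschitz).comp (hY j)

theorem locallyLipschitz_minors {n q : ℕ} {Y : Fin q → VField n}
    (hY : ∀ j, LocallyLipschitz (Y j)) (p : ℕ) :
    LocallyLipschitz fun x => (coeffMatrix Y x).minors p := by
  refine LocallyLipschitz.pi (f := fun s x => (coeffMatrix Y x).minors p s) fun s => ?_
  have hG : LocallyLipschitz fun x (j : Fin q) (i : Fin n) => coeffMatrix Y x j i :=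
    LocallyLipschitz.pi fun j => LocallyLipschitz.pi fun i =>
      locallyLipschitz_coeffMatrix_apply hY j i
  have hdet : ContDiff ℝ 1 fun G : Fin q → Fin n → ℝ =>
      ∑ σ : Equiv.Perm (Fin p), ((Equiv.Perm.sign σ : ℤ) : ℝ) * ∏ a, G (s.1 (σ a)) (s.2 a) := by
    fun_prop
  have h := hdet.locallyLipschitz.comp hG
  convert h using 2 with x
  simp [Matrix.minors, Matrix.det_apply']

/-- The structure of the velocity of the coefficients along a curve: `D Yᵢ(w)`, for
`w = ∑ uⱼ Yⱼ(y)`, is a linear map applied to `Yᵢ(x)`, plus a combination of the fields at `x`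
coming from the brackets, plus an error due to `y ≠ x`. -/
theorem fderiv_apply_eq_mul_add_mul_add {n q : ℕ} {Y : Fin q → VField n}
    {x y : EuclideanSpace ℝ (Fin n)} (u : Fin q → ℝ)
    {c : Fin q → Fin q → EuclideanSpace ℝ (Fin q)}
    (hc : ∀ j i, VectorField.lieBracket ℝ (Y j) (Y i) x = ∑ l, c j i l • Y l x)
    (i : Fin q) (b : Fin n) :
    fderiv ℝ (Y i) x (∑ j, u j • Y j y) b =
      (coeffMatrix Y x * (Matrix.of fun m b =>
          ∑ j, u j * fderiv ℝ (Y j) x (EuclideanSpace.single m 1) b)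
        + (Matrix.of fun i l => ∑ j, u j * c j i l) * coeffMatrix Y x
        + Matrix.of fun i b => fderiv ℝ (Y i) x (∑ j, u j • (Y j y - Y j x)) b) i b := by
  have hsplit : ∑ j, u j • Y j y = ∑ j, u j • Y j x + ∑ j, u j • (Y j y - Y j x) := by
    rw [← Finset.sum_add_distrib]
    exact Finset.sum_congr rfl fun j _ => by rw [← smul_add, add_sub_cancel]
  have hbr : ∀ j, fderiv ℝ (Y i) x (Y j x)
      = fderiv ℝ (Y j) x (Y i x) + ∑ l, c j i l • Y l x := fun j => by
    rw [← hc, VectorField.lieBracket]; abel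
  have hbasis : ∀ j, fderiv ℝ (Y j) x (Y i x)
      = ∑ m, Y i x m • fderiv ℝ (Y j) x (EuclideanSpace.single m 1) := fun j => by
    conv_lhs => rw [← (EuclideanSpace.basisFun (Fin n) ℝ).sum_repr (Y i x)]
    simp
  rw [hsplit, map_add, map_sum]
  simp_rw [map_smul, hbr, hbasis]
  simp only [Matrix.add_apply, Matrix.mul_apply, Matrix.of_apply, coeffMatrix, PiLp.add_apply,
    WithLp.ofLp_sum, WithLp.ofLp_smul, Finset.sum_apply, Pi.smul_apply, smul_eq_mul, mul_add,
    Finset.mul_sum, Finset.sum_mul, Finset.sum_add_distrib, WithLp.ofLp_add, Pi.add_apply]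
  congr 2
  · rw [Finset.sum_comm]
    exact Finset.sum_congr rfl fun _ _ => Finset.sum_congr rfl fun _ _ => by ring
  · rw [Finset.sum_comm]
    exact Finset.sum_congr rfl fun _ _ => Finset.sum_congr rfl fun _ _ => by ring

theorem EuclideanSpace.norm_apply_le {ι : Type*} [Fintype ι] (v : EuclideanSpace ℝ ι) (i : ι) :
    |v i| ≤ ‖v‖ := PiLp.norm_apply_le v i

theorem norm_sum_smul_le_card_mul {q : ℕ} {E : Type*} [NormedAddCommGroup E] [NormedSpace ℝ E]
    {u : EuclideanSpace ℝ (Fin q)} (hu : ‖u‖ ≤ 1) {v : Fin q → E} {r : ℝ}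
    (hv : ∀ j, ‖v j‖ ≤ r) : ‖∑ j, u j • v j‖ ≤ q * r := by
  refine (norm_sum_le _ _).trans ((Finset.sum_le_card_nsmul _ _ r fun j _ => ?_).trans_eq
    (by simp))
  rw [norm_smul, Real.norm_eq_abs]
  calc |u j| * ‖v j‖ ≤ 1 * ‖v j‖ := by
        gcongr; exact (EuclideanSpace.norm_apply_le u j).trans hu
    _ ≤ r := by rw [one_mul]; exact hv j

/-- At a point `x` where the fields are differentiable and the bracket condition holds, the minors
along a curve through `x` with velocity `∑ uⱼ Yⱼ(y)` change at a rate controlled by the minors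
themselves, up to an error proportional to `r`, a bound for `|y - x|`. -/
theorem exists_hasDerivAt_minors_le {n q : ℕ} {Y : Fin q → VField n} {p : ℕ}
    {η : ℝ → EuclideanSpace ℝ (Fin n)} {t : ℝ} {y : EuclideanSpace ℝ (Fin n)}
    {u : EuclideanSpace ℝ (Fin q)} (hu : ‖u‖ ≤ 1)
    (hη : HasDerivAt η (∑ j, u j • Y j y) t)
    (hd : ∀ j, DifferentiableAt ℝ (Y j) (η t)) {C L M r : ℝ}
    (hL : ∀ j, ‖fderiv ℝ (Y j) (η t)‖ ≤ L)
    (hC : ∀ j k, VectorField.lieBracket ℝ (Y j) (Y k) (η t) ∈ distributionBall Y (η t) C)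
    (hM : 1 ≤ M) (hYM : ∀ j, ‖Y j (η t)‖ ≤ M) (hL0 : 0 ≤ L)
    (hr : ∀ j, ‖Y j y - Y j (η t)‖ ≤ L * r) (s : (Fin p → Fin q) × (Fin p → Fin n)) :
    ∃ D, HasDerivAt (fun τ => (coeffMatrix Y (η τ)).minors p s) D t ∧
      |D| ≤ (p * (n * (q * L)) + p * (q * (q * C))) * ‖(coeffMatrix Y (η t)).minors p‖
        + p * (p * (L * (q * (L * r)) * (p.factorial * M ^ p))) := by
  choose c hcC hc using hC
  have hcoeff : ∀ i b, HasDerivAt (fun τ => coeffMatrix Y (η τ) i b)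
      (fderiv ℝ (Y i) (η t) (∑ j, u j • Y j y) b) t := fun i b =>
    (EuclideanSpace.proj (𝕜 := ℝ) b).hasFDerivAt.comp_hasDerivAt t
      ((hd i).hasFDerivAt.comp_hasDerivAt t hη)
  refine ⟨_, HasDerivAt.matrix_det fun a b => hcoeff (s.1 a) (s.2 b), ?_⟩
  simp_rw [fderiv_apply_eq_mul_add_mul_add u hc]
  have := Matrix.abs_sum_mul_adjugate_le (p := p) (coeffMatrix Y (η t))
    (Matrix.of fun m b => ∑ j, u j * fderiv ℝ (Y j) (η t) (EuclideanSpace.single m 1) b)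
    (Matrix.of fun i l => ∑ j, u j * c j i l)
    (Matrix.of fun i b => fderiv ℝ (Y i) (η t) (∑ j, u j • (Y j y - Y j (η t))) b)
    (α := q * L) (β := q * C) (δ := L * (q * (L * r))) hM
    (fun i j => (EuclideanSpace.norm_apply_le (Y i (η t)) j).trans (hYM i))
    (fun m b => norm_sum_smul_le_card_mul hu (v := fun j =>
      fderiv ℝ (Y j) (η t) (EuclideanSpace.single m 1) b) fun j => by
        refine (EuclideanSpace.norm_apply_le _ b).trans ?_
        refine (ContinuousLinearMap.le_opNorm _ _).trans ?_
        simpa using hL j)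
    (fun i l => norm_sum_smul_le_card_mul hu (v := fun j => c j i l) fun j =>
      (EuclideanSpace.norm_apply_le _ l).trans (hcC j i))
    (fun i b => by
      refine (EuclideanSpace.norm_apply_le _ b).trans ?_
      refine (ContinuousLinearMap.le_opNorm _ _).trans ?_
      exact mul_le_mul (hL i) (norm_sum_smul_le_card_mul hu hr) (norm_nonneg _) hL0)
    s.1 s.2
  simpa using this

/-! ### Translated curves and Grönwall's lemma -/

/-- A property that holds almost everywhere holds, for almost every translate of a curve, at almost
every time. -/
theorem ae_ae_add_of_ae {E : Type*} [NormedAddCommGroup E] [MeasurableSpace E] [BorelSpace E]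
    [SecondCountableTopology E] {μ : Measure E} [SFinite μ] [μ.IsAddLeftInvariant]
    {γ : ℝ → E} (hγ : Continuous γ) {P : E → Prop} (hP : ∀ᵐ x ∂μ, P x) :
    ∀ᵐ z ∂μ, ∀ᵐ t : ℝ, P (γ t + z) := by
  set N := toMeasurable μ {x | ¬ P x}
  have hN : ∀ᵐ x ∂μ, x ∉ N := by
    simpa [ae_iff, N, measure_toMeasurable] using hP
  have hmeas : MeasurableSet {w : E × ℝ | γ w.2 + w.1 ∉ N} :=
    (((hγ.comp continuous_snd).add continuous_fst).measurable
      (measurableSet_toMeasurable μ _)).compl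
  have h : ∀ᵐ z ∂μ, ∀ᵐ t : ℝ, γ t + z ∉ N := by
    rw [Measure.ae_ae_comm hmeas]
    exact Filter.Eventually.of_forall fun t =>
      (measurePreserving_add_left μ (γ t)).quasiMeasurePreserving.ae hN
  filter_upwards [h] with z hz
  filter_upwards [hz] with t ht
  by_contra hcon
  exact ht (subset_toMeasurable μ _ hcon)

theorem LipschitzOnWith.abs_sub_le_integral {f g : ℝ → ℝ} {a b : ℝ} {K : ℝ≥0} (hab : a ≤ b)
    (hf : LipschitzOnWith K f (Icc a b)) (hg : IntervalIntegrable g volume a b)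
    (h : ∀ᵐ t, t ∈ Ioc a b → |deriv f t| ≤ g t) : |f b - f a| ≤ ∫ t in a..b, g t := by
  rw [← uIcc_of_le hab] at hf
  rw [← hf.absolutelyContinuousOnInterval.integral_deriv_eq_sub]
  exact intervalIntegral.norm_integral_le_of_norm_le (f := deriv f) hab h hg

/-- Grönwall's lemma in integral form, with zero initial value. -/
theorem eq_zero_of_norm_sub_le_integral {E : Type*} [NormedAddCommGroup E] {φ : ℝ → E}
    (hφ : Continuous φ) {c T : ℝ}
    (h : ∀ t ∈ Icc 0 T, ‖φ t - φ 0‖ ≤ c * ∫ τ in (0 : ℝ)..t, ‖φ τ‖) (h0 : φ 0 = 0) :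
    ∀ t ∈ Icc 0 T, φ t = 0 := by
  have hder : ∀ t, HasDerivAt (fun t => ∫ τ in (0 : ℝ)..t, ‖φ τ‖) ‖φ t‖ t := fun t =>
    hφ.norm.integral_hasStrictDerivAt 0 t |>.hasDerivAt
  have hz := eq_zero_of_abs_deriv_le_mul_abs_self_of_eq_zero_right (K := c) (a := 0) (b := T)
    (fun t _ => (hder t).continuousAt.continuousWithinAt)
    (fun t _ => (hder t).hasDerivWithinAt) (by simp) fun t ht => by
      have hnn : 0 ≤ ∫ τ in (0 : ℝ)..t, ‖φ τ‖ :=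
        intervalIntegral.integral_nonneg ht.1 fun _ _ => norm_nonneg _
      simpa [h0, Real.norm_of_nonneg hnn] using h t (Ico_subset_Icc_self ht)
  intro t ht
  have := h t ht
  rw [hz t ht, mul_zero, h0, sub_zero] at this
  exact norm_le_zero_iff.1 this

theorem eq_zero_iff_of_norm_sub_le_integral {E : Type*} [NormedAddCommGroup E] {φ : ℝ → E}
    (hφ : Continuous φ) {c T : ℝ} (hT : 0 ≤ T)
    (h : ∀ s t, 0 ≤ s → s ≤ t → t ≤ T → ‖φ t - φ s‖ ≤ c * ∫ τ in s..t, ‖φ τ‖) :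
    φ T = 0 ↔ φ 0 = 0 := by
  constructor
  · intro hz
    have := eq_zero_of_norm_sub_le_integral (φ := fun t => φ (T - t)) (c := c) (T := T)
      (by fun_prop) (fun t ht => by
        rw [norm_sub_rev]
        have h1 := h (T - t) T (by linarith [ht.2]) (by linarith [ht.1]) le_rfl
        rw [intervalIntegral.integral_comp_sub_left (fun τ => ‖φ τ‖) T]
        simpa using h1) (by simpa using hz) T ⟨hT, le_rfl⟩
    simpa using this
  · intro hz
    exact eq_zero_of_norm_sub_le_integral hφ (fun t ht => h 0 t le_rfl ht.1 ht.2) hz T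
      ⟨hT, le_rfl⟩

/-! ### Minors along subunit paths -/

/-- Rademacher's theorem and the bracket condition, combined: almost every point of the ball is one
at which the differential inequality for the minors can be derived. -/
theorem ae_good_point {n q : ℕ} {Y : Fin q → VField n} (hY : ∀ j, LocallyLipschitz (Y j))
    {R C : ℝ}
    (hC : ∀ j k, ∀ᵐ x ∂volume.restrict (Metric.ball (0 : EuclideanSpace ℝ (Fin n)) R),
      VectorField.lieBracket ℝ (Y j) (Y k) x ∈ distributionBall Y x C) :
    ∀ᵐ x : EuclideanSpace ℝ (Fin n), x ∈ Metric.ball 0 R →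
      (∀ j, DifferentiableAt ℝ (Y j) x) ∧
      ∀ j k, VectorField.lieBracket ℝ (Y j) (Y k) x ∈ distributionBall Y x C := by
  have hd : ∀ j, ∀ᵐ x : EuclideanSpace ℝ (Fin n), x ∈ Metric.ball 0 R →
      DifferentiableAt ℝ (Y j) x := fun j => by
    obtain ⟨K, hK⟩ := ((hY j).locallyLipschitzOn
      (s := Metric.closedBall 0 R)).exists_lipschitzOnWith_of_compact (isCompact_closedBall _ _)
    filter_upwards [(hK.mono Metric.ball_subset_closedBall).ae_differentiableWithinAt_of_mem
      (μ := volume)] with x hx hxR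
    exact (hx hxR).differentiableAt (Metric.isOpen_ball.mem_nhds hxR)
  have hC' := fun j k => (ae_restrict_iff' Metric.isOpen_ball.measurableSet).1 (hC j k)
  filter_upwards [ae_all_iff.2 hd, ae_all_iff.2 fun j => ae_all_iff.2 (hC' j)] with x h1 h2 hx
  exact ⟨fun j => h1 j hx, fun j k => h2 j k hx⟩

/-- The differential inequality for the minors along a subunit path, in integral form. -/
theorem exists_norm_minors_sub_le_integral {n q : ℕ} {Y : Fin q → VField n}
    (hY : ∀ j, LocallyLipschitz (Y j)) (hInv : FiniteTypeInvolutive Y) (p : ℕ)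
    {γ : ℝ → EuclideanSpace ℝ (Fin n)} {Kγ : ℝ≥0} (hγ : LipschitzWith Kγ γ) {T R : ℝ}
    (hR : ∀ t, ‖γ t‖ ≤ R) {u : ℝ → EuclideanSpace ℝ (Fin q)}
    (hu : ∀ᵐ t ∂volume.restrict (Ioo 0 T),
      ‖u t‖ ≤ 1 ∧ HasDerivAt γ (∑ j, u t j • Y j (γ t)) t) :
    ∃ c : ℝ, ∀ s t, 0 ≤ s → s ≤ t → t ≤ T →
      ‖(coeffMatrix Y (γ t)).minors p - (coeffMatrix Y (γ s)).minors p‖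
        ≤ c * ∫ τ in s..t, ‖(coeffMatrix Y (γ τ)).minors p‖ := by
  set F : EuclideanSpace ℝ (Fin n) → (Fin p → Fin q) × (Fin p → Fin n) → ℝ :=
    fun x => (coeffMatrix Y x).minors p with hF
  -- Uniform constants on a ball containing the unit neighbourhood of the path.
  obtain ⟨C, hC0, hC⟩ := hInv (Metric.ball 0 (R + 1)) Metric.isOpen_ball Metric.isBounded_ball
  have hgood := ae_good_point hY hC
  have hcpt := isCompact_closedBall (0 : EuclideanSpace ℝ (Fin n)) (R + 1)
  obtain ⟨L, hL⟩ := ((LocallyLipschitz.pi hY).locallyLipschitzOn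
    (s := Metric.closedBall 0 (R + 1))).exists_lipschitzOnWith_of_compact hcpt
  replace hL : ∀ j, LipschitzOnWith L (Y j) (Metric.closedBall 0 (R + 1)) := fun j x hx y hy =>
    (edist_le_pi_edist (fun i => Y i x) (fun i => Y i y) j).trans (hL hx hy)
  obtain ⟨LF, hLF⟩ := ((locallyLipschitz_minors hY p).locallyLipschitzOn
    (s := Metric.closedBall 0 (R + 1))).exists_lipschitzOnWith_of_compact hcpt
  change LipschitzOnWith LF F _ at hLF
  obtain ⟨M₀, hM₀⟩ := hcpt.exists_bound_of_continuousOn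
    (f := fun x j => Y j x) (LocallyLipschitz.pi hY).continuous.continuousOn
  set M := max M₀ 1
  have hYM : ∀ x ∈ Metric.closedBall 0 (R + 1), ∀ j, ‖Y j x‖ ≤ M := fun x hx j =>
    (norm_le_pi_norm (fun j => Y j x) j).trans ((hM₀ x hx).trans (le_max_left _ _))
  have hFc : Continuous fun τ => ‖F (γ τ)‖ :=
    ((locallyLipschitz_minors hY p).continuous.comp hγ.continuous).norm
  set c₁ : ℝ := p * (n * (q * L)) + p * (q * (q * C))
  set c₂ : ℝ := p * (p * (L * (q * L) * (p.factorial * M ^ p)))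
  refine ⟨c₁, fun s t hs hst htT => ?_⟩
  have hI0 : 0 ≤ ∫ τ in s..t, ‖F (γ τ)‖ :=
    intervalIntegral.integral_nonneg hst fun _ _ => norm_nonneg _
  have hc₁ : 0 ≤ c₁ := by positivity
  have hc₂ : 0 ≤ c₂ := by positivity
  -- The path is compared with its translate by a short vector `z` such that `γ + z` meets good
  -- points at almost every time; the error is then removed by letting `ε → 0`.
  set c₃ : ℝ := (c₁ * LF + c₂) * (t - s) + 2 * LF
  have hmain : ∀ ε : ℝ, 0 < ε →
      ‖F (γ t) - F (γ s)‖ ≤ c₁ * (∫ τ in s..t, ‖F (γ τ)‖) + c₃ * ε := by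
    intro ε hε
    obtain ⟨z, hzε, hz⟩ := (Measure.dense_of_ae
      (ae_ae_add_of_ae hγ.continuous hgood)).inter_open_nonempty
      (Metric.ball 0 (min ε 1)) Metric.isOpen_ball ⟨0, Metric.mem_ball_self (lt_min hε one_pos)⟩
    rw [mem_ball_zero_iff, lt_min_iff] at hzε
    have hγB : ∀ τ, γ τ ∈ Metric.closedBall 0 (R + 1) := fun τ =>
      mem_closedBall_zero_iff.2 ((hR τ).trans (by linarith))
    have hzB' : ∀ τ, γ τ + z ∈ Metric.ball 0 (R + 1) := fun τ =>
      mem_ball_zero_iff.2 ((norm_add_le _ _).trans_lt (add_lt_add_of_le_of_lt (hR τ) hzε.2))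
    have hzB : ∀ τ, γ τ + z ∈ Metric.closedBall 0 (R + 1) := fun τ =>
      Metric.ball_subset_closedBall (hzB' τ)
    have hFz : ∀ τ, ‖F (γ τ + z) - F (γ τ)‖ ≤ LF * ε := fun τ => by
      refine (hLF.norm_sub_le (hzB τ) (hγB τ)).trans ?_
      rw [add_sub_cancel_left]
      gcongr
      exact hzε.1.le
    have hbound : ‖F (γ t + z) - F (γ s + z)‖
        ≤ ∫ τ in s..t, (c₁ * ‖F (γ τ)‖ + (c₁ * LF + c₂) * ε) := by
      have hint : Continuous fun τ => c₁ * ‖F (γ τ)‖ + (c₁ * LF + c₂) * ε := by fun_prop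
      refine (pi_norm_le_iff_of_nonneg (intervalIntegral.integral_nonneg hst fun τ _ => by
        positivity)).2 fun i => ?_
      have hlip : LipschitzOnWith (LF * Kγ) (fun τ => F (γ τ + z) i) (Icc s t) :=
        fun a _ b _ => (edist_le_pi_edist (F (γ a + z)) (F (γ b + z)) i).trans <|
          (hLF (hzB a) (hzB b)).trans <| by
            rw [edist_add_right, ENNReal.coe_mul, mul_assoc]
            gcongr
            exact hγ a b
      refine hlip.abs_sub_le_integral hst (hint.intervalIntegrable _ _) ?_
      -- The equation for `γ` holds on the open interval `(0, T)`, while `t` may be `T`.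
      have hne : ∀ᵐ τ : ℝ, τ ≠ T := by simp [ae_iff]
      filter_upwards [hz, (ae_restrict_iff' measurableSet_Ioo).1 hu, hne] with τ hτ huτ hτT hmem
      obtain ⟨hu1, hder⟩ := huτ ⟨hs.trans_lt hmem.1, lt_of_le_of_ne (hmem.2.trans htT) hτT⟩
      obtain ⟨hd, hbr⟩ := hτ (hzB' τ)
      have hnhds := Metric.isOpen_ball.mem_nhds (hzB' τ)
      obtain ⟨D, hD, hDle⟩ := exists_hasDerivAt_minors_le (p := p) (η := fun τ => γ τ + z) hu1
        (hder.add_const z) hd (L := L) (C := C) (M := M) (r := ε)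
        (fun j => norm_fderiv_le_of_lipschitzOn ℝ
          (Filter.mem_of_superset hnhds Metric.ball_subset_closedBall) (hL j)) hbr
        (le_max_right _ _) (hYM _ (hzB τ)) L.2
        (fun j => by
          refine ((hL j).norm_sub_le (hγB τ) (hzB τ)).trans ?_
          rw [sub_add_cancel_left, norm_neg]
          gcongr
          exact hzε.1.le) i
      rw [hD.deriv]
      refine hDle.trans ?_
      have hFle : ‖F (γ τ + z)‖ ≤ ‖F (γ τ)‖ + LF * ε := by
        have := norm_le_norm_add_norm_sub' (F (γ τ + z)) (F (γ τ))
        linarith [hFz τ]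
      have := mul_le_mul_of_nonneg_left hFle hc₁
      calc _ = c₁ * ‖F (γ τ + z)‖ + c₂ * ε := by simp only [c₁, c₂, F]; ring
        _ ≤ _ := by linarith
    rw [intervalIntegral.integral_add ((hFc.const_mul c₁).intervalIntegrable _ _)
      (by simp), intervalIntegral.integral_const_mul, intervalIntegral.integral_const,
      smul_eq_mul] at hbound
    have htri : ‖F (γ t) - F (γ s)‖ ≤ ‖F (γ t + z) - F (γ s + z)‖
        + ‖F (γ t + z) - F (γ t)‖ + ‖F (γ s + z) - F (γ s)‖ := by
      have : F (γ t) - F (γ s) = (F (γ t + z) - F (γ s + z)) - (F (γ t + z) - F (γ t))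
        + (F (γ s + z) - F (γ s)) := by abel
      rw [this]
      exact (norm_add_le _ _).trans (by gcongr; exact norm_sub_le _ _)
    calc _ ≤ _ := htri
      _ ≤ _ := by simp only [c₃]; linarith [hFz t, hFz s]
  have hc₃ : 0 ≤ c₃ := by
    have : 0 ≤ t - s := sub_nonneg.2 hst
    positivity
  refine le_of_forall_pos_le_add fun ε hε => ?_
  refine (hmain (ε / (c₃ + 1)) (by positivity)).trans ?_
  gcongr
  rw [mul_div_assoc', div_le_iff₀ (by positivity)]
  nlinarith

/-- The rank is the same at the two ends of a subunit path. -/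
theorem IsSubunit.rankAt_eq {n q : ℕ} {Y : Fin q → VField n}
    (hY : ∀ j, LocallyLipschitz (Y j)) (hInv : FiniteTypeInvolutive Y) {T : ℝ} (hT : 0 ≤ T)
    {γ : ℝ → EuclideanSpace ℝ (Fin n)} (hγ : IsSubunit Y T γ) :
    rankAt Y (γ T) = rankAt Y (γ 0) := by
  obtain ⟨⟨K, hK⟩, u, -, hu⟩ := hγ
  -- Outside `[0, T]` the path is arbitrary, so it is replaced by its constant extension.
  set γ' : ℝ → EuclideanSpace ℝ (Fin n) := IccExtend hT ((Icc 0 T).domRestrict γ)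
  have hγ' : LipschitzWith K γ' := by
    have h := hK.to_restrict.comp (LipschitzWith.projIcc hT)
    rwa [mul_one] at h
  have heq : ∀ t ∈ Icc 0 T, γ' t = γ t := fun t ht => IccExtend_of_mem hT _ ht
  obtain ⟨R, hR⟩ := isCompact_Icc.exists_bound_of_continuousOn hK.continuousOn
  have hR' : ∀ t, ‖γ' t‖ ≤ R := fun t => hR _ (projIcc 0 T hT t).2
  have hu' : ∀ᵐ t ∂volume.restrict (Ioo 0 T),
      ‖u t‖ ≤ 1 ∧ HasDerivAt γ' (∑ j, u t j • Y j (γ' t)) t := by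
    filter_upwards [hu, ae_restrict_mem measurableSet_Ioo] with t ht hmem
    rw [heq t (Ioo_subset_Icc_self hmem)]
    refine ⟨ht.1, ht.2.congr_of_eventuallyEq ?_⟩
    filter_upwards [isOpen_Ioo.mem_nhds hmem] with τ hτ
    exact heq τ (Ioo_subset_Icc_self hτ)
  rw [← heq T ⟨hT, le_rfl⟩, ← heq 0 ⟨le_rfl, hT⟩]
  refine eq_of_forall_le_iff fun p => ?_
  obtain ⟨c, hc⟩ := exists_norm_minors_sub_le_integral hY hInv p hγ' hR' hu'
  rw [le_rankAt_iff, le_rankAt_iff]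
  exact (eq_zero_iff_of_norm_sub_le_integral
    ((locallyLipschitz_minors hY p).continuous.comp hγ'.continuous) hT hc).not

theorem theorem2p1 (n q : ℕ) (Y : Fin q → VField n)
    (hLip : ∀ j, LocallyLipschitz (Y j))
    (hInv : FiniteTypeInvolutive Y) :
    ∀ x₀ : EuclideanSpace ℝ (Fin n), ∀ x ∈ orbit Y x₀, rankAt Y x = rankAt Y x₀ := by
  intro x₀ x hx
  obtain ⟨-, ⟨T, hT, -, γ, hγ, rfl, rfl⟩, -⟩ := sInf_lt_iff.1 (show ccDist Y x₀ x < ∞ from hx)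
  exact hγ.rankAt_eq hLip hInv hT
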